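/- An ultrafilter $\mathcal U$ on $\omega$ is \emph{selective} if for every $f:\omega\to\omega$ there is $A\in\mathcal U$ such that $f$ is constant or one-to-one on $A$. For $k,l\in\omega$, a set $A\subseteq 2^l$ is \emph{$k$-big} if for every $\sigma:k\to2$ there is $\tau\in A$ with $\sigma\subseteq\tau$. Let $\mathbb T'=\bigcup_{l\in\omega}\prod_{k<l}2^k$. For a set $T\subseteq\mathbb T'$ closed under restrictions and $f\in T$, let $\mathrm{succ}_T(f)=\{\sigma: f^\frown\langle\sigma\rangle\in T\}$. Let $\mathcal U$ be a selective ultrafilter on $\omega$. Let $\mathbb P(\mathcal U)$ be the set of all $T\subseteq\mathbb T'$, closed under restrictions, such that (1) $\emptyset\in T$; (2) for every $f\in T$ and every $n\ge\mathrm{dom}(f)$ there is $g\in T$ with $f\subseteq g$ and $n\le\mathrm{dom}(g)$; (3) for every $k\in\omega$, the set of all $l\in\omega$ such that $\mathrm{succ}_T(f)$ is $k$-big for every $f\in T$ with $\mathrm{dom}(f)=l$ belongs to $\mathcal U$. Order $\mathbb P(\mathcal U)$ by inclusion ($q\le p$ iff $q\subseteq p$). Suppose $\mathbb Q$ is an $\omega^\omega$-bounding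 forcing (every function $\omega\to\omega$ in a generic extension by $\mathbb Q$ is bounded everywhere by a ground model function) such that $\mathbb P(\mathcal U)$ completely embeds into $\mathbb Q$, that is, there is a map $\pi:\mathbb P(\mathcal U)\to\mathbb Q$ which preserves order, preserves compatibility and incompatibility, and is such that for every $q\in\mathbb Q$ there is $p\in\mathbb P(\mathcal U)$ with $\pi(p')$ compatible with $q$ for all $p'\le p$. Then $$\Vdash_{\mathbb Q}\ \text{``there is no selective ultrafilter on }\omega\text{ extending }\mathcal U\text{''}.$$ -/

import Mathlib

universe u

/-! ### Names and the forcing relation -/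

namespace Forcing

/-- `Q`-names: a name is a family (indexed by a type of the universe of `Q`) of pairs
consisting of a name and a condition. -/
inductive PName (Q : Type u) : Type (u + 1)
  | mk (ι : Type u) (name : ι → PName Q) (cond : ι → Q) : PName Q

namespace PName

variable {Q : Type u}

/-- The index type of a name. -/
def Idx : PName Q → Type u
  | mk ι _ _ => ι

/-- The names occurring in a name. -/
def name : (x : PName Q) → x.Idx → PName Q
  | mk _ a _ => a

/-- The conditions occurring in a name. -/
def cond : (x : PName Q) → x.Idx → Q
  | mk _ _ c => c

/-- The name `{(a i, q) : i ∈ ι, q ∈ Q}`; it denotes the set `{a i : i ∈ ι}` in every generic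
extension. -/
def collect {ι : Type} (a : ι → PName Q) : PName Q :=
  mk (ULift.{u} ι × Q) (fun i => a i.1.down) (fun i => i.2)

/-- The unordered pair `{x, y}`. -/
def upair (x y : PName Q) : PName Q :=
  collect (fun b : Bool => bif b then x else y)

/-- The Kuratowski ordered pair `{{x}, {x, y}}`. -/
def opair (x y : PName Q) : PName Q :=
  upair (upair x x) (upair x y)

/-- The canonical name of the natural number `n = {0, …, n - 1}`. -/
def nat (n : ℕ) : PName Q :=
  collect (fun i : Fin n => nat i.1)
termination_by n
decreasing_by exact i.2

/-- The canonical name of `ω`. -/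
def omega : PName Q := collect (fun n : ℕ => nat n)

/-- The canonical name of a ground model set of natural numbers. -/
def ofSet (A : Set ℕ) : PName Q := collect (fun n : A => nat n.1)

/-- The canonical name of a ground model function `g : ω → ω`. -/
def ofFun (g : ℕ → ℕ) : PName Q := collect (fun n : ℕ => opair (nat n) (nat (g n)))

/-- The canonical name of a ground model ultrafilter on `ω`. -/
def ofUltrafilter (U : Ultrafilter ℕ) : PName Q :=
  collect (fun A : {A : Set ℕ // A ∈ U} => ofSet A.1)

end PName

/-- A sentence of the forcing language, given by the conditions that force it:
`φ p` means that `p` forces `φ`. -/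
abbrev Sentence (Q : Type u) := Q → Prop

section Relation

variable {Q : Type u} [Preorder Q]

/-- `p ⊩ x = y`: whenever `q ≤ p` and `(z, c) ∈ x` with `q ≤ c`, the conditions `s` such that
`s ⊩ z = w` for some `(w, d) ∈ y` with `s ≤ d` are dense below `q`; and symmetrically. -/
def eq : PName Q → PName Q → Sentence Q
  | .mk ι a c, .mk κ b d => fun p =>
    (∀ i : ι, ∀ q ≤ p, q ≤ c i → ∀ r ≤ q, ∃ s ≤ r, ∃ j : κ, s ≤ d j ∧ eq (a i) (b j) s) ∧
    (∀ j : κ, ∀ q ≤ p, q ≤ d j → ∀ r ≤ q, ∃ s ≤ r, ∃ i : ι, s ≤ c i ∧ eq (a i) (b j) s)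

/-- `p ⊩ x ∈ y`: the conditions `r` such that `r ⊩ x = z` for some `(z, d) ∈ y` with `r ≤ d`
are dense below `p`. -/
def mem (x y : PName Q) : Sentence Q := fun p =>
  ∀ q ≤ p, ∃ r ≤ q, ∃ j : y.Idx, r ≤ y.cond j ∧ eq x (y.name j) r

/-- `p ⊩ ¬ φ`: no extension of `p` forces `φ`. -/
def neg (φ : Sentence Q) : Sentence Q := fun p => ∀ q ≤ p, ¬ φ q

/-- `p ⊩ φ ∧ ψ`. -/
def and (φ ψ : Sentence Q) : Sentence Q := fun p => φ p ∧ ψ p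

/-- `p ⊩ φ ∨ ψ`: the conditions forcing `φ` or forcing `ψ` are dense below `p`. -/
def or (φ ψ : Sentence Q) : Sentence Q := fun p => ∀ q ≤ p, ∃ r ≤ q, φ r ∨ ψ r

/-- `p ⊩ φ → ψ`: every extension of `p` that forces `φ` forces `ψ`. -/
def imp (φ ψ : Sentence Q) : Sentence Q := fun p => ∀ q ≤ p, φ q → ψ q

/-- `p ⊩ ∀ x, φ x`, where `x` ranges over all names. -/
def all (φ : PName Q → Sentence Q) : Sentence Q := fun p => ∀ x, φ x p

/-- `p ⊩ ∃ x, φ x`: the conditions forcing `φ x` for some name `x` are dense below `p`. -/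
def ex (φ : PName Q → Sentence Q) : Sentence Q := fun p => ∀ q ≤ p, ∃ r ≤ q, ∃ x, φ x r

/-- `∀ x ∈ y, φ x`. -/
def allMem (y : PName Q) (φ : PName Q → Sentence Q) : Sentence Q :=
  all fun x => imp (mem x y) (φ x)

/-- `∃ x ∈ y, φ x`. -/
def exMem (y : PName Q) (φ : PName Q → Sentence Q) : Sentence Q :=
  ex fun x => and (mem x y) (φ x)

/-- `x ⊆ y`. -/
def subset (x y : PName Q) : Sentence Q := allMem x fun z => mem z y

/-- `z = x ∩ y`. -/
def isInter (z x y : PName Q) : Sentence Q :=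
  and (and (subset z x) (subset z y)) (allMem x fun w => imp (mem w y) (mem w z))

/-- `z = x \ y`. -/
def isDiff (z x y : PName Q) : Sentence Q :=
  and (allMem z fun w => and (mem w x) (neg (mem w y)))
    (allMem x fun w => imp (neg (mem w y)) (mem w z))

/-- `f` is a function from `ω` to `ω`. -/
def isFun (f : PName Q) : Sentence Q :=
  and (allMem f fun z => exMem .omega fun m => exMem .omega fun n => eq z (.opair m n))
    (allMem .omega fun m => exMem .omega fun n =>
      and (mem (.opair m n) f) (all fun n' => imp (mem (.opair m n') f) (eq n' n)))

/-- `f n ≤ g n` for all `n ∈ ω`, where `f` and `g` are functions from `ω` to `ω`. -/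
def funLe (f g : PName Q) : Sentence Q :=
  allMem .omega fun n => allMem .omega fun k => allMem .omega fun l =>
    imp (and (mem (.opair n k) f) (mem (.opair n l) g)) (or (mem k l) (eq k l))

/-- The function `f` is constant on the set `A`. -/
def constOn (f A : PName Q) : Sentence Q :=
  allMem A fun m => allMem A fun n => all fun k => all fun l =>
    imp (and (mem (.opair m k) f) (mem (.opair n l) f)) (eq k l)

/-- The function `f` is one-to-one on the set `A`. -/
def injOn (f A : PName Q) : Sentence Q :=
  allMem A fun m => allMem A fun n => all fun k =>
    imp (and (mem (.opair m k) f) (mem (.opair n k) f)) (eq m n)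

/-- `V` is an ultrafilter on `ω`. -/
def isUltrafilter (V : PName Q) : Sentence Q :=
  and (allMem V fun A => subset A .omega) <|
  and (mem .omega V) <|
  and (allMem V fun A => ex fun n => mem n A) <|
  and (allMem V fun A => all fun B => imp (and (subset A B) (subset B .omega)) (mem B V)) <|
  and (allMem V fun A => allMem V fun B => all fun C => imp (isInter C A B) (mem C V)) <|
  all fun A => imp (subset A .omega) (all fun B => imp (isDiff B .omega A) (or (mem A V) (mem B V)))

/-- `V` is a selective ultrafilter on `ω`: every `f : ω → ω` is constant or one-to-one on some
member of `V`. -/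
def isSelective (V : PName Q) : Sentence Q :=
  and (isUltrafilter V) <|
    all fun f => imp (isFun f) (exMem V fun A => or (constOn f A) (injOn f A))

end Relation

/-- `Q` is `ω^ω`-bounding: whenever `p` forces that `f` is a function from `ω` to `ω`, some
`q ≤ p` forces `f` to be bounded everywhere by some ground model function `g`. -/
def OmegaOmegaBounding (Q : Type u) [Preorder Q] : Prop :=
  ∀ (p : Q) (f : PName Q), isFun f p → ∃ q ≤ p, ∃ g : ℕ → ℕ, funLe f (.ofFun g) q

/-- Two conditions are compatible if they have a common extension. -/
def Compat {P : Type*} [Preorder P] (p q : P) : Prop := ∃ r, r ≤ p ∧ r ≤ q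

/-- `i : P → Q` is a complete embedding: it preserves order and incompatibility, and every
condition of `Q` has a reduction to `P`. -/
structure IsCompleteEmbedding {P Q : Type*} [Preorder P] [Preorder Q] (i : P → Q) : Prop where
  le_of_le : ∀ p p' : P, p' ≤ p → i p' ≤ i p
  compat_iff : ∀ p p' : P, Compat p p' ↔ Compat (i p) (i p')
  reduction : ∀ q : Q, ∃ p : P, ∀ p' ≤ p, Compat (i p') q

end Forcing

/-! ### Selective ultrafilters and the forcing `ℙ(U)` -/

/-- An ultrafilter on `ω` is selective if every `f : ω → ω` is constant or one-to-one on one of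
its members. -/
def IsSelectiveUltrafilter (U : Ultrafilter ℕ) : Prop :=
  ∀ f : ℕ → ℕ, ∃ A ∈ U, (∃ c, ∀ n ∈ A, f n = c) ∨ Set.InjOn f A

/-- `A ⊆ 2^l` is `k`-big if every `σ : k → 2` is extended by some `τ ∈ A`. -/
def IsBig (k : ℕ) {l : ℕ} (A : Set (Fin l → Bool)) : Prop :=
  ∀ σ : Fin k → Bool, ∃ τ ∈ A, ∃ h : k ≤ l, ∀ i : Fin k, τ (Fin.castLE h i) = σ i

/-- The `l`-th level `∏_{k < l} 2^k` of the full tree. -/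
abbrev Node (l : ℕ) : Type := (k : Fin l) → (Fin (k : ℕ) → Bool)

/-- The restriction of a node to a smaller length. -/
def Node.restrict {l m : ℕ} (h : l ≤ m) (g : Node m) : Node l := fun k => g (Fin.castLE h k)

/-- A set of nodes, given by its levels. -/
abbrev NodeSet : Type := (l : ℕ) → Set (Node l)

/-- The set of immediate successors of the node `f` in `T`. -/
def NodeSet.succ (T : NodeSet) {l : ℕ} (f : Node l) : Set (Fin l → Bool) :=
  {σ | ∃ g ∈ T (l + 1), g.restrict (Nat.le_succ l) = f ∧ g (Fin.last l) = σ}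

/-- `U`-conditions. -/
structure IsUCondition (U : Ultrafilter ℕ) (T : NodeSet) : Prop where
  /-- `T` is a subtree. -/
  subtree : ∀ (l m : ℕ) (h : l ≤ m), ∀ g ∈ T m, g.restrict h ∈ T l
  /-- The empty sequence belongs to `T`. -/
  root : ∀ f : Node 0, f ∈ T 0
  /-- Every node of `T` has arbitrarily long extensions in `T`. -/
  extend : ∀ (l : ℕ), ∀ f ∈ T l, ∀ n, l ≤ n → ∃ (m : ℕ) (h : l ≤ m), n ≤ m ∧
    ∃ g ∈ T m, g.restrict h = f
  /-- For every `k`, for `U`-almost all `l` the nodes on level `l` have `k`-big sets of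
  successors. -/
  big : ∀ k : ℕ, {l : ℕ | ∀ f ∈ T l, IsBig k (T.succ f)} ∈ U

/-- The forcing `ℙ(U)` of all `U`-conditions. -/
def PU (U : Ultrafilter ℕ) : Type := {T : NodeSet // IsUCondition U T}

/-- `ℙ(U)` is ordered by inclusion. -/
instance (U : Ultrafilter ℕ) : PartialOrder (PU U) where
  le q p := ∀ l, q.1 l ⊆ p.1 l
  le_refl _ _ := subset_rfl
  le_trans _ _ _ h h' l := (h l).trans (h' l)
  le_antisymm _ _ h h' := Subtype.ext (funext fun l => (h l).antisymm (h' l))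

/-! The generic branch for `ℙ(U)` assigns to each `l` a string `s_l ∈ 2^l`. Let `V ⊇ U` be an
ultrafilter in the extension. For each `j` there is one bit `b_j` with `s_l(j) = b_j` for `V`-almost
all `l`. Let `f(l)` be the least `n` with `s_l(n) ≠ b_n`, or `l` if there is none (`Differs`,
`funName`). On a set in `V` the function `f` cannot be constant with value `n`, since almost all
`s_l` agree with `b_n` at `n` (`not_constOn_differs`). If `V` is selective, `f` is therefore
one-to-one on some `A ∈ V`.

Injectivity makes `f` tend to infinity on `A`, and `ω^ω`-bounding gives a ground model `h` such that
`s_l` agrees with `b` below `k` whenever `l ∈ A` and `l ≥ h(k)` (`exists_bound_of_injOn`). Some bit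
`c` equals `b_j` for infinitely many `j` (`exists_frequent_bitSet`); bounding again gives a ground
model `g` with such a `j` in every `(z, g(z+1)]`. Although `b` itself is unknown to the ground
model, `c`, `g` and `h` suffice to prune a condition: at all levels `l` of some `Z ∈ U` the entry is
made constantly `!c` on an interval `(z, g(z+1)]` with `h(g(z+1)+1) ≤ l` (`PU.exists_le_eq_on`).
Selectivity of `U` makes the intervals fit while preserving bigness (`exists_diagonal`). Any `l ∈ A
∩ Z` then gives a contradiction.

No generic filter is used: each step is a density argument about names. -/

namespace Forcing

variable {Q : Type u} [Preorder Q]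

/-! ### Forced equality and membership -/

theorem mem_mono {x y : PName Q} {p q : Q} (h : mem x y p) (hq : q ≤ p) : mem x y q :=
  fun r hr => h r (hr.trans hq)

theorem mem_of_dense {x y : PName Q} {p : Q} (h : ∀ q ≤ p, ∃ r ≤ q, mem x y r) : mem x y p := by
  intro q hq
  obtain ⟨r, hr, hm⟩ := h q hq
  obtain ⟨s, hs, h⟩ := hm r le_rfl
  exact ⟨s, hs.trans hr, h⟩

theorem eq_iff (x y : PName Q) (p : Q) : eq x y p ↔
    (∀ i, ∀ q ≤ p, q ≤ x.cond i → ∀ r ≤ q, ∃ s ≤ r, ∃ j, s ≤ y.cond j ∧ eq (x.name i) (y.name j) s) ∧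
    (∀ j, ∀ q ≤ p, q ≤ y.cond j → ∀ r ≤ q, ∃ s ≤ r, ∃ i, s ≤ x.cond i ∧
      eq (x.name i) (y.name j) s) := by
  cases x; cases y; rw [eq]; rfl

theorem eq_mono {x y : PName Q} {p q : Q} (h : eq x y p) (hq : q ≤ p) : eq x y q := by
  rw [eq_iff] at h ⊢
  exact ⟨fun i r hr => h.1 i r (hr.trans hq), fun j r hr => h.2 j r (hr.trans hq)⟩

theorem eq_of_dense {x y : PName Q} {p : Q} (h : ∀ q ≤ p, ∃ r ≤ q, eq x y r) : eq x y p := by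
  rw [eq_iff]
  constructor
  · intro i q hq hqi r hr
    obtain ⟨s, hs, he⟩ := h r (hr.trans hq)
    obtain ⟨t, ht, h⟩ := ((eq_iff ..).1 he).1 i s le_rfl ((hs.trans hr).trans hqi) s le_rfl
    exact ⟨t, ht.trans hs, h⟩
  · intro i q hq hqi r hr
    obtain ⟨s, hs, he⟩ := h r (hr.trans hq)
    obtain ⟨t, ht, h⟩ := ((eq_iff ..).1 he).2 i s le_rfl ((hs.trans hr).trans hqi) s le_rfl
    exact ⟨t, ht.trans hs, h⟩

theorem eq_refl (x : PName Q) (p : Q) : eq x x p := by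
  induction x generalizing p with
  | mk ι a c ih =>
    rw [eq]
    exact ⟨fun i q _ hi r hr => ⟨r, le_rfl, i, hr.trans hi, ih i r⟩,
      fun i q _ hi r hr => ⟨r, le_rfl, i, hr.trans hi, ih i r⟩⟩

theorem eq_symm {x y : PName Q} {p : Q} (h : eq x y p) : eq y x p := by
  induction x generalizing y p with
  | mk ι a c ih =>
    cases y with
    | mk κ b d =>
      rw [eq] at h ⊢
      constructor
      · intro j q hq hj r hr
        obtain ⟨s, hs, i, hi, he⟩ := h.2 j q hq hj r hr
        exact ⟨s, hs, i, hi, ih i he⟩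
      · intro j q hq hj r hr
        obtain ⟨s, hs, i, hi, he⟩ := h.1 j q hq hj r hr
        exact ⟨s, hs, i, hi, ih _ he⟩

theorem eq_trans {x y z : PName Q} {p : Q} (h : eq x y p) (h' : eq y z p) : eq x z p := by
  induction x generalizing y z p with
  | mk ι a c ih =>
    rw [eq_iff] at h h' ⊢
    constructor
    · intro i q hq hi r hr
      obtain ⟨s, hs, j, hj, he⟩ := h.1 i q hq hi r hr
      obtain ⟨t, ht, k, hk, he'⟩ := h'.1 j s (hs.trans (hr.trans hq)) hj s le_rfl
      exact ⟨t, ht.trans hs, k, hk, ih i (eq_mono he ht) he'⟩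
    · intro i q hq hi r hr
      obtain ⟨s, hs, j, hj, he⟩ := h'.2 i q hq hi r hr
      obtain ⟨t, ht, k, hk, he'⟩ := h.2 j s (hs.trans (hr.trans hq)) hj s le_rfl
      exact ⟨t, ht.trans hs, k, hk, ih k he' (eq_mono he ht)⟩

theorem mem_congr_left {x x' y : PName Q} {p : Q} (h : eq x x' p) (hm : mem x y p) :
    mem x' y p := by
  intro q hq
  obtain ⟨r, hr, j, hj, he⟩ := hm q hq
  exact ⟨r, hr, j, hj, eq_trans (eq_symm (eq_mono h (hr.trans hq))) he⟩

theorem mem_congr_right {x y y' : PName Q} {p : Q} (h : eq y y' p) (hm : mem x y p) :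
    mem x y' p := by
  intro q hq
  obtain ⟨r, hr, j, hj, he⟩ := hm q hq
  obtain ⟨s, hs, k, hk, he'⟩ := ((eq_iff ..).1 h).1 j r (hr.trans hq) hj r le_rfl
  exact ⟨s, hs.trans hr, k, hk, eq_trans (eq_mono he hs) he'⟩

theorem eq_of_forall_mem {x y : PName Q} {p : Q}
    (h : ∀ z, ∀ q ≤ p, mem z x q ↔ mem z y q) : eq x y p := by
  rw [eq_iff]
  constructor
  · intro i q hq hi r hr
    exact (h (x.name i) q hq).1
      (fun s hs => ⟨s, le_rfl, i, hs.trans hi, eq_refl _ _⟩) r hr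
  · intro i q hq hi r hr
    obtain ⟨s, hs, j, hj, he⟩ := (h (y.name i) q hq).2
      (fun s hs => ⟨s, le_rfl, i, hs.trans hi, eq_refl _ _⟩) r hr
    exact ⟨s, hs, j, hj, eq_symm he⟩

/-- Forced equality as an equivalence relation on names. -/
def eqSetoid (p : Q) : Setoid (PName Q) where
  r x y := eq x y p
  iseqv := ⟨fun x => eq_refl x p, eq_symm, eq_trans⟩

/-- At a fixed condition, this trades forced equality for genuine equality in a quotient, so that
`rw` and `grind` can do the equational reasoning. -/
theorem eq_iff_quotient {x y : PName Q} {p : Q} :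
    eq x y p ↔ (Quotient.mk (eqSetoid p) x) = Quotient.mk (eqSetoid p) y :=
  (Quotient.eq (r := eqSetoid p)).symm

/-! ### Pairs, numerals and ground model sets -/

theorem mem_collect {ι : Type} {a : ι → PName Q} {x : PName Q} {p : Q} :
    mem x (.collect a) p ↔ ∀ q ≤ p, ∃ r ≤ q, ∃ i, eq x (a i) r := by
  constructor
  · intro h q hq
    obtain ⟨r, hr, j, -, he⟩ := h q hq
    exact ⟨r, hr, j.1.down, he⟩
  · intro h q hq
    obtain ⟨r, hr, i, he⟩ := h q hq
    exact ⟨r, hr, (⟨i⟩, r), le_rfl, he⟩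

theorem mem_collect_self {ι : Type} (a : ι → PName Q) (i : ι) (p : Q) :
    mem (a i) (.collect a) p :=
  mem_collect.2 fun q _ => ⟨q, le_rfl, i, eq_refl _ _⟩

theorem mem_upair {x a b : PName Q} {p : Q} :
    mem x (.upair a b) p ↔ ∀ q ≤ p, ∃ r ≤ q, eq x a r ∨ eq x b r := by
  rw [PName.upair, mem_collect]
  refine forall₂_congr fun q _ => exists_congr fun r => and_congr_right fun _ => ?_
  simp [Bool.exists_bool, or_comm]

theorem mem_upair_left (a b : PName Q) (p : Q) : mem a (.upair a b) p :=
  mem_collect_self (fun b' : Bool => bif b' then a else b) true p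

theorem mem_upair_right (a b : PName Q) (p : Q) : mem b (.upair a b) p :=
  mem_collect_self (fun b' : Bool => bif b' then a else b) false p

theorem upair_congr {a b c d : PName Q} {p : Q} (h : eq a c p) (h' : eq b d p) :
    eq (.upair a b) (.upair c d) p := by
  refine eq_of_forall_mem fun z q hq => ?_
  rw [mem_upair, mem_upair]
  refine forall₂_congr fun r hr => exists_congr fun s => and_congr_right fun hs => ?_
  have h1 := eq_mono h (hs.trans (hr.trans hq))
  have h2 := eq_mono h' (hs.trans (hr.trans hq))
  rw [eq_iff_quotient] at h1 h2
  rw [eq_iff_quotient, eq_iff_quotient, eq_iff_quotient, eq_iff_quotient, h1, h2]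

theorem opair_congr {a b c d : PName Q} {p : Q} (h : eq a c p) (h' : eq b d p) :
    eq (.opair a b) (.opair c d) p :=
  upair_congr (upair_congr h h) (upair_congr h h')

theorem eq_of_upair_eq {a b c d : PName Q} {p : Q} (h : eq (.upair a b) (.upair c d) p) :
    ∃ q ≤ p, (eq a c q ∧ eq b d q) ∨ (eq a d q ∧ eq b c q) := by
  obtain ⟨q₁, h₁, e₁⟩ := mem_upair.1 (mem_congr_right h (mem_upair_left a b p)) p le_rfl
  obtain ⟨q₂, h₂, e₂⟩ := mem_upair.1 (mem_congr_right h (mem_upair_right a b p)) q₁ h₁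
  obtain ⟨q₃, h₃, e₃⟩ :=
    mem_upair.1 (mem_congr_right (eq_symm h) (mem_upair_left c d p)) q₂ (h₂.trans h₁)
  obtain ⟨q₄, h₄, e₄⟩ :=
    mem_upair.1 (mem_congr_right (eq_symm h) (mem_upair_right c d p)) q₃ (h₃.trans (h₂.trans h₁))
  refine ⟨q₄, h₄.trans (h₃.trans (h₂.trans h₁)), ?_⟩
  have f₁ := e₁.imp (eq_mono · (h₄.trans (h₃.trans h₂))) (eq_mono · (h₄.trans (h₃.trans h₂)))
  have f₂ := e₂.imp (eq_mono · (h₄.trans h₃)) (eq_mono · (h₄.trans h₃))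
  have f₃ := e₃.imp (eq_mono · h₄) (eq_mono · h₄)
  simp only [eq_iff_quotient] at f₁ f₂ f₃ e₄ ⊢
  grind

/-- Which way the members of two equal unordered pairs match is decided only by extensions. The
components are thus identified densely, and the equalities are glued by `eq_of_dense`. -/
theorem eq_of_opair_eq {a b c d : PName Q} {p : Q} (h : eq (.opair a b) (.opair c d) p) :
    eq a c p ∧ eq b d p := by
  have key : ∀ q ≤ p, ∃ r ≤ q, eq a c r ∧ eq b d r := by
    intro q hq
    obtain ⟨r, hr, ⟨h₁, h₂⟩ | ⟨h₁, h₂⟩⟩ := eq_of_upair_eq (eq_mono h hq)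
    · obtain ⟨s, hs, e₁⟩ := eq_of_upair_eq h₁
      obtain ⟨t, ht, e₂⟩ := eq_of_upair_eq (eq_mono h₂ hs)
      refine ⟨t, ht.trans (hs.trans hr), ?_⟩
      have e₃ := e₁.imp (And.imp (eq_mono · ht) (eq_mono · ht))
        (And.imp (eq_mono · ht) (eq_mono · ht))
      simp only [eq_iff_quotient] at e₂ e₃ ⊢
      grind
    · obtain ⟨s, hs, e₁⟩ := eq_of_upair_eq h₁
      obtain ⟨t, ht, e₂⟩ := eq_of_upair_eq (eq_mono h₂ hs)
      refine ⟨t, ht.trans (hs.trans hr), ?_⟩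
      have e₃ := e₁.imp (And.imp (eq_mono · ht) (eq_mono · ht))
        (And.imp (eq_mono · ht) (eq_mono · ht))
      simp only [eq_iff_quotient] at e₂ e₃ ⊢
      grind
  constructor
  · refine eq_of_dense fun q hq => ?_
    obtain ⟨r, hr, h, -⟩ := key q hq
    exact ⟨r, hr, h⟩
  · refine eq_of_dense fun q hq => ?_
    obtain ⟨r, hr, -, h⟩ := key q hq
    exact ⟨r, hr, h⟩

theorem mem_nat {x : PName Q} {n : ℕ} {p : Q} :
    mem x (.nat n) p ↔ ∀ q ≤ p, ∃ r ≤ q, ∃ i < n, eq x (.nat i) r := by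
  rw [PName.nat, mem_collect]
  refine forall₂_congr fun q _ => exists_congr fun r => and_congr_right fun _ => ?_
  exact ⟨fun ⟨i, h⟩ => ⟨i, i.2, h⟩, fun ⟨i, hi, h⟩ => ⟨⟨i, hi⟩, h⟩⟩

/-- Foundation by descent: equality with the larger numeral would put `m` into itself, hence make it
equal to a smaller numeral. -/
theorem not_eq_nat_of_lt {m n : ℕ} (h : m < n) (p : Q) : ¬ eq (.nat n) (.nat m) p := by
  induction n using Nat.strong_induction_on generalizing m p with
  | _ n ih =>
    intro he
    have h₁ : mem (.nat m) (.nat n) p := mem_nat.2 fun q _ => ⟨q, le_rfl, m, h, eq_refl _ _⟩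
    obtain ⟨r, -, i, hi, e⟩ := mem_nat.1 (mem_congr_right he h₁) p le_rfl
    exact ih m h hi r e

theorem nat_eq_nat {m n : ℕ} {p : Q} : eq (.nat m) (.nat n) p ↔ m = n := by
  refine ⟨fun h => ?_, fun h => h ▸ eq_refl _ _⟩
  rcases lt_trichotomy m n with h' | h' | h'
  · exact (not_eq_nat_of_lt h' p (eq_symm h)).elim
  · exact h'
  · exact (not_eq_nat_of_lt h' p h).elim

theorem nat_mem_nat {m n : ℕ} {p : Q} : mem (.nat m) (.nat n) p ↔ m < n := by
  rw [mem_nat]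
  refine ⟨fun h => ?_, fun h q _ => ⟨q, le_rfl, m, h, eq_refl _ _⟩⟩
  obtain ⟨r, -, i, hi, e⟩ := h p le_rfl
  exact nat_eq_nat.1 e ▸ hi

theorem nat_mem_omega (n : ℕ) (p : Q) : mem (.nat n) .omega p :=
  mem_collect_self (fun n : ℕ => (PName.nat n : PName Q)) n p

theorem exists_eq_nat_of_mem_omega {x : PName Q} {p : Q} (h : mem x .omega p) :
    ∃ q ≤ p, ∃ n, eq x (.nat n) q :=
  mem_collect.1 h p le_rfl

theorem nat_mem_ofSet {A : Set ℕ} {n : ℕ} {p : Q} (h : mem (.nat n) (.ofSet A) p) : n ∈ A := by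
  obtain ⟨r, -, i, e⟩ := mem_collect.1 h p le_rfl
  exact nat_eq_nat.1 e ▸ i.2

theorem ofSet_mem_ofUltrafilter {U : Ultrafilter ℕ} {A : Set ℕ} (h : A ∈ U) (p : Q) :
    mem (.ofSet A) (.ofUltrafilter U) p :=
  mem_collect_self (fun A : {A : Set ℕ // A ∈ U} => (PName.ofSet A.1 : PName Q)) ⟨A, h⟩ p

/-! ### Names of sets of natural numbers -/

/-- The name of the set of those `n` for which a condition satisfying `S n` is generic. -/
def setName (S : ℕ → Q → Prop) : PName Q :=
  .mk {x : ULift.{u} ℕ × Q // S x.1.down x.2} (fun x => .nat x.1.1.down) (fun x => x.1.2)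

theorem mem_setName {S : ℕ → Q → Prop} {x : PName Q} {p : Q} :
    mem x (setName S) p ↔ ∀ q ≤ p, ∃ r ≤ q, ∃ n c, S n c ∧ r ≤ c ∧ eq x (.nat n) r := by
  refine forall₂_congr fun q _ => exists_congr fun r => and_congr_right fun _ => ?_
  exact ⟨fun ⟨j, h, e⟩ => ⟨j.1.1.down, j.1.2, j.2, h, e⟩,
    fun ⟨n, c, hS, h, e⟩ => ⟨⟨(⟨n⟩, c), hS⟩, h, e⟩⟩

theorem nat_mem_setName_of {S : ℕ → Q → Prop} {n : ℕ} {p : Q} (h : S n p) :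
    mem (.nat n) (setName S) p :=
  mem_setName.2 fun q hq => ⟨q, le_rfl, n, p, h, hq, eq_refl _ _⟩

theorem exists_of_nat_mem_setName {S : ℕ → Q → Prop} {n : ℕ} {p : Q}
    (h : mem (.nat n) (setName S) p) : ∃ q ≤ p, ∃ c, q ≤ c ∧ S n c := by
  obtain ⟨r, hr, m, c, hS, hc, e⟩ := mem_setName.1 h p le_rfl
  exact ⟨r, hr, c, hc, nat_eq_nat.1 e ▸ hS⟩

theorem setName_subset_omega (S : ℕ → Q → Prop) (p : Q) : subset (setName S) .omega p := by
  intro x q _ h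
  refine mem_of_dense fun r hr => ?_
  obtain ⟨s, hs, n, c, -, -, e⟩ := mem_setName.1 h r hr
  exact ⟨s, hs, mem_congr_left (eq_symm e) (nat_mem_omega n s)⟩

/-- The name of the complement of a subset of `ω`. -/
def complName (A : PName Q) : PName Q := setName fun n p => ∀ q ≤ p, ¬ mem (.nat n) A q

theorem not_mem_of_mem_complName {A : PName Q} {n : ℕ} {p : Q}
    (h : mem (.nat n) (complName A) p) : ¬ mem (.nat n) A p := by
  intro h'
  obtain ⟨q, hq, c, hc, hn⟩ := exists_of_nat_mem_setName h
  exact hn q hc (mem_mono h' hq)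

theorem isDiff_complName (A : PName Q) (p : Q) : isDiff (complName A) .omega A p := by
  refine ⟨fun x q _ hx => ⟨setName_subset_omega _ q x q le_rfl hx, fun r hr hA => ?_⟩,
    fun x q _ hx r hr hA => ?_⟩
  · obtain ⟨s, hs, n, c, hn, hc, e⟩ := mem_setName.1 hx r hr
    exact hn s hc (mem_congr_left e (mem_mono hA hs))
  · refine mem_of_dense fun s hs => ?_
    obtain ⟨t, ht, n, e⟩ := exists_eq_nat_of_mem_omega (mem_mono hx (hs.trans hr))
    refine ⟨t, ht, mem_congr_left (eq_symm e) (nat_mem_setName_of fun w hw hm => ?_)⟩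
    exact hA w (hw.trans (ht.trans hs)) (mem_congr_left (eq_symm (eq_mono e hw)) hm)

/-- The name of the intersection of two subsets of `ω`. -/
def interName (A B : PName Q) : PName Q :=
  setName fun n p => mem (.nat n) A p ∧ mem (.nat n) B p

theorem mem_interName {A B : PName Q} {x : PName Q} {p : Q} (h : mem x (interName A B) p) :
    mem x A p ∧ mem x B p := by
  constructor <;>
  · refine mem_of_dense fun q hq => ?_
    obtain ⟨r, hr, n, c, hn, hc, e⟩ := mem_setName.1 h q hq
    first
    | exact ⟨r, hr, mem_congr_left (eq_symm e) (mem_mono hn.1 hc)⟩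
    | exact ⟨r, hr, mem_congr_left (eq_symm e) (mem_mono hn.2 hc)⟩

theorem isInter_interName {A B : PName Q} {p : Q} (h : subset A .omega p) :
    isInter (interName A B) A B p := by
  refine ⟨⟨fun x q _ hx => (mem_interName hx).1, fun x q _ hx => (mem_interName hx).2⟩,
    fun x q hq hA r hr hB => mem_of_dense fun s hs => ?_⟩
  obtain ⟨t, ht, n, e⟩ :=
    exists_eq_nat_of_mem_omega (h x s (hs.trans (hr.trans hq)) (mem_mono hA (hs.trans hr)))
  exact ⟨t, ht, mem_congr_left (eq_symm e) (nat_mem_setName_of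
    ⟨mem_congr_left e (mem_mono hA (ht.trans (hs.trans hr))),
      mem_congr_left e (mem_mono hB (ht.trans hs))⟩)⟩

/-! ### Ultrafilters in the extension -/

theorem isUltrafilter_mono {V : PName Q} {p q : Q} (h : isUltrafilter V p) (hq : q ≤ p) :
    isUltrafilter V q :=
  ⟨fun x r hr => h.1 x r (hr.trans hq), mem_mono h.2.1 hq,
    fun x r hr => h.2.2.1 x r (hr.trans hq), fun x r hr => h.2.2.2.1 x r (hr.trans hq),
    fun x r hr => h.2.2.2.2.1 x r (hr.trans hq), fun x r hr => h.2.2.2.2.2 x r (hr.trans hq)⟩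

theorem interName_mem {V A B : PName Q} {p : Q} (hV : isUltrafilter V p) (hA : mem A V p)
    (hB : mem B V p) : mem (interName A B) V p :=
  hV.2.2.2.2.1 A p le_rfl hA B p le_rfl hB _ p le_rfl
    (isInter_interName (hV.1 A p le_rfl hA))

theorem exists_nat_mem_of_mem {V A : PName Q} {p : Q} (hV : isUltrafilter V p)
    (hA : mem A V p) : ∃ q ≤ p, ∃ n, mem (.nat n) A q := by
  obtain ⟨r, hr, x, hx⟩ := hV.2.2.1 A p le_rfl hA p le_rfl
  obtain ⟨s, hs, n, e⟩ := exists_eq_nat_of_mem_omega (hV.1 A p le_rfl hA x r hr hx)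
  exact ⟨s, hs.trans hr, n, mem_congr_left e (mem_mono hx hs)⟩

theorem mem_or_complName_mem {V A : PName Q} {p : Q} (hV : isUltrafilter V p)
    (hA : subset A .omega p) : ∃ q ≤ p, mem A V q ∨ mem (complName A) V q :=
  hV.2.2.2.2.2 A p le_rfl hA _ p le_rfl (isDiff_complName A p) p le_rfl

/-! ### Names of functions -/

/-- `p` decides that `n` is the least number satisfying `R k`. -/
def Least (R : ℕ → ℕ → Q → Prop) (k n : ℕ) (p : Q) : Prop :=
  R k n p ∧ ∀ m < n, ∀ q ≤ p, ¬ R k m q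

theorem exists_least {R : ℕ → ℕ → Q → Prop} {k n : ℕ} {p : Q} (h : R k n p) :
    ∃ q ≤ p, ∃ m ≤ n, Least R k m q := by
  classical
  have hex : ∃ m, ∃ q ≤ p, R k m q := ⟨n, p, le_rfl, h⟩
  obtain ⟨q, hq, hm⟩ := Nat.find_spec hex
  exact ⟨q, hq, Nat.find hex, Nat.find_min' hex ⟨p, le_rfl, h⟩, hm,
    fun m hlt r hr hRm => Nat.find_min hex hlt ⟨r, hr.trans hq, hRm⟩⟩

/-- The name of the function sending `k` to the least `n` satisfying `R k`. -/
def funName (R : ℕ → ℕ → Q → Prop) : PName Q :=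
  .mk {x : ULift.{u} (ℕ × ℕ) × Q // Least R x.1.down.1 x.1.down.2 x.2}
    (fun x => .opair (.nat x.1.1.down.1) (.nat x.1.1.down.2)) (fun x => x.1.2)

theorem mem_funName {R : ℕ → ℕ → Q → Prop} {x : PName Q} {p : Q} :
    mem x (funName R) p ↔ ∀ q ≤ p, ∃ r ≤ q, ∃ k n c, Least R k n c ∧ r ≤ c ∧
      eq x (.opair (.nat k) (.nat n)) r := by
  refine forall₂_congr fun q _ => exists_congr fun r => and_congr_right fun _ => ?_
  exact ⟨fun ⟨j, h, e⟩ => ⟨j.1.1.down.1, j.1.1.down.2, j.1.2, j.2, h, e⟩,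
    fun ⟨k, n, c, hS, h, e⟩ => ⟨⟨(⟨k, n⟩, c), hS⟩, h, e⟩⟩

theorem opair_mem_funName {R : ℕ → ℕ → Q → Prop} {k n : ℕ} {p : Q} (h : Least R k n p) :
    mem (.opair (.nat k) (.nat n)) (funName R) p :=
  mem_funName.2 fun q hq => ⟨q, le_rfl, k, n, p, h, hq, eq_refl _ _⟩

/-- The value is unique because two conditions deciding different least values are incompatible: by
`hR`, a common extension would witness the smaller value against the minimality of the larger. -/
theorem isFun_funName {R : ℕ → ℕ → Q → Prop} (hR : ∀ k n p q, q ≤ p → R k n p → R k n q)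
    {p : Q} (hd : ∀ k, ∀ q ≤ p, ∃ r ≤ q, ∃ n, R k n r) : isFun (funName R) p := by
  constructor
  · intro z q _ hz q' hq'
    obtain ⟨r, hr, k, n, c, -, -, e⟩ := mem_funName.1 hz q' hq'
    exact ⟨r, hr, .nat k, nat_mem_omega _ _, fun s hs =>
      ⟨s, le_rfl, .nat n, nat_mem_omega _ _, eq_mono e hs⟩⟩
  · intro m q hq hm q' hq'
    obtain ⟨r, hr, k, e⟩ := exists_eq_nat_of_mem_omega (mem_mono hm hq')
    obtain ⟨s, hs, n₀, h₀⟩ := hd k r (hr.trans (hq'.trans hq))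
    obtain ⟨t, ht, n, -, hn⟩ := exists_least h₀
    have e' := eq_mono e (ht.trans hs)
    refine ⟨t, ht.trans (hs.trans hr), .nat n, nat_mem_omega _ _,
      mem_congr_left (opair_congr (eq_symm e') (eq_refl _ _)) (opair_mem_funName hn),
      fun n' t' ht' hn' => eq_of_dense fun w hw => ?_⟩
    obtain ⟨v, hv, k', l, c, hl, hc, e₁⟩ := mem_funName.1 hn' w hw
    obtain ⟨e₂, e₃⟩ := eq_of_opair_eq e₁
    have hvt := hv.trans (hw.trans ht')
    have hk : k = k' := nat_eq_nat.1 (eq_trans (eq_symm (eq_mono e' hvt)) e₂)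
    subst hk
    have hnl : l = n := by
      rcases lt_trichotomy l n with h | h | h
      · exact (hn.2 l h v hvt (hR _ _ _ _ hc hl.1)).elim
      · exact h
      · exact (hl.2 n h v hc (hR _ _ _ _ hvt hn.1)).elim
    subst hnl
    exact ⟨v, hv, e₃⟩

/-- In an `ω^ω`-bounding forcing, witnesses that exist densely can be bounded by a ground model
function. -/
theorem OmegaOmegaBounding.exists_bound (hQ : OmegaOmegaBounding Q) {R : ℕ → ℕ → Q → Prop}
    (hR : ∀ k n p q, q ≤ p → R k n p → R k n q) {p : Q}
    (hd : ∀ k, ∀ q ≤ p, ∃ r ≤ q, ∃ n, R k n r) :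
    ∃ q ≤ p, ∃ g : ℕ → ℕ, ∀ k, ∀ r ≤ q, ∃ s ≤ r, ∃ n ≤ g k, R k n s := by
  obtain ⟨q, hq, g, hg⟩ := hQ p _ (isFun_funName hR hd)
  refine ⟨q, hq, g, fun k r hr => ?_⟩
  obtain ⟨s, hs, n₀, h₀⟩ := hd k r (hr.trans hq)
  -- The bound from `hg` concerns the value of the name, which is the least witness; so the witness
  -- is first made least.
  obtain ⟨t, ht, n, -, hn⟩ := exists_least h₀
  have htq := ht.trans (hs.trans hr)
  obtain ⟨v, hv, hle⟩ := hg (.nat k) t htq (nat_mem_omega _ _) (.nat n) t le_rfl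
    (nat_mem_omega _ _) (.nat (g k)) t le_rfl (nat_mem_omega _ _) t le_rfl
    ⟨opair_mem_funName hn,
      mem_collect_self (fun n : ℕ => (PName.opair (.nat n) (.nat (g n)) : PName Q)) k t⟩ t le_rfl
  refine ⟨v, hv.trans (ht.trans hs), n, ?_, hR _ _ _ _ hv hn.1⟩
  rcases hle with h | h
  · exact (nat_mem_nat.1 h).le
  · exact (nat_eq_nat.1 h).le

end Forcing

/-! ### Diagonalization for selective ultrafilters -/

theorem exists_strictMono_ge (h : ℕ → ℕ) :
    ∃ a : ℕ → ℕ, StrictMono a ∧ ∀ n, h (a n) ≤ a (n + 1) := by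
  let a : ℕ → ℕ := fun n => Nat.rec 0 (fun _ x => max (x + 1) (h x)) n
  exact ⟨a, strictMono_nat_of_lt_succ fun n => Nat.lt_of_lt_of_le (Nat.lt_succ_self _)
    (le_max_left (a n + 1) (h (a n))), fun n => le_max_right (a n + 1) (h (a n))⟩

theorem exists_mem_injOn {U : Ultrafilter ℕ} (hU : IsSelectiveUltrafilter U) {f : ℕ → ℕ}
    (hf : ∀ c, {l | f l ≠ c} ∈ U) : ∃ A ∈ U, Set.InjOn f A := by
  obtain ⟨A, hA, ⟨c, hc⟩ | h⟩ := hU f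
  · obtain ⟨l, hl, hl'⟩ := U.nonempty_of_mem (Filter.inter_mem hA (hf c))
    exact (hl' (hc l hl)).elim
  · exact ⟨A, hA, h⟩

/-- Selectivity is used twice: first for a set almost contained in every `W z`, then to thin it so
that each element lies beyond the finite exceptions belonging to its predecessors. -/
theorem IsSelectiveUltrafilter.exists_diagonal {U : Ultrafilter ℕ}
    (hU : IsSelectiveUltrafilter U) (hne : ∀ n, {l | n ≤ l} ∈ U) {W : ℕ → Set ℕ}
    (hW : ∀ z, W z ∈ U) : ∃ Z ∈ U, ∀ z ∈ Z, ∀ l ∈ Z, z < l → l ∈ W z := by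
  classical
  -- A decreasing version of `W`; the clause `z + 1 ≤ l` ensures that every `l` eventually drops
  -- out, so `f` is defined.
  let W' : ℕ → Set ℕ := fun z => {l | z + 1 ≤ l} ∩ ⋂ i ∈ Finset.range (z + 1), W i
  have hW' : ∀ z, W' z ∈ U := fun z =>
    Filter.inter_mem (hne _) ((Filter.biInter_finset_mem _).2 fun i _ => hW i)
  have hsub : ∀ z z', z ≤ z' → W' z' ⊆ W z := fun z z' h l hl =>
    Set.mem_iInter₂.1 hl.2 z (Finset.mem_range.2 (by omega))
  have hex : ∀ l, ∃ z, l ∉ W' z := fun l => ⟨l, fun h => absurd h.1 (by simp)⟩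
  let f : ℕ → ℕ := fun l => Nat.find (hex l)
  have hf : ∀ l z, z < f l → l ∈ W' z := fun l z h => not_not.1 (Nat.find_min (hex l) h)
  have hs : ∀ l, l ∉ W' (f l) := fun l => Nat.find_spec (hex l)
  obtain ⟨A, hA, hinj⟩ := exists_mem_injOn hU (f := f) fun c =>
    Filter.mem_of_superset (hW' c) fun l hl hc => hs l (by rw [hc]; exact hl)
  have hfin : ∀ z, ∃ N, ∀ l ∈ A, N ≤ l → z < f l := by
    intro z
    have h1 : (A ∩ f ⁻¹' Set.Iic z).Finite :=
      Set.Finite.of_finite_image ((Set.finite_Iic z).subset (by rintro _ ⟨l, hl, rfl⟩; exact hl.2))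
        (hinj.mono Set.inter_subset_left)
    obtain ⟨N, hN⟩ := h1.bddAbove
    refine ⟨N + 1, fun l hl hle => ?_⟩
    by_contra hlt
    have := hN ⟨hl, not_lt.1 hlt⟩
    omega
  choose h hh using hfin
  obtain ⟨a, ha, hah⟩ := exists_strictMono_ge h
  -- The index of the interval `[a n, a (n + 1))` containing `l`.
  let e : ℕ → ℕ := fun l => Nat.find (⟨l, (ha.id_le (l + 1))⟩ : ∃ n, l + 1 ≤ a (n + 1))
  have he : ∀ l, l < a (e l + 1) := fun l =>
    Nat.find_spec (⟨l, (ha.id_le (l + 1))⟩ : ∃ n, l + 1 ≤ a (n + 1))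
  have he' : ∀ l n, n < e l → a (n + 1) ≤ l := fun l n hn =>
    Nat.lt_succ_iff.1 (not_le.1 (Nat.find_min
      (⟨l, (ha.id_le (l + 1))⟩ : ∃ n, l + 1 ≤ a (n + 1)) hn))
  obtain ⟨B, hB, hinj'⟩ := exists_mem_injOn hU (f := e) fun c =>
    Filter.mem_of_superset (hne (a (c + 1))) fun l hl hc => by
      have := he l
      rw [hc] at this
      exact absurd this (not_lt.2 hl)
  -- Fixing the parity of the index makes distinct chosen intervals non-adjacent, so a whole
  -- interval separates `z` from `l`, enough to pass `h (a (e z + 1))`.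
  obtain ⟨C, hC, hpar⟩ : ∃ C ∈ U, ∀ l ∈ C, ∀ m ∈ C, e l % 2 = e m % 2 := by
    rcases U.mem_or_compl_mem {l | e l % 2 = 0} with h0 | h0
    · exact ⟨_, h0, fun l hl m hm => hl.trans hm.symm⟩
    · refine ⟨_, h0, fun l hl m hm => ?_⟩
      simp only [Set.mem_compl_iff, Set.mem_ofPred_eq] at hl hm
      omega
  refine ⟨A ∩ (B ∩ C), Filter.inter_mem hA (Filter.inter_mem hB hC), fun z hz l hl hlt => ?_⟩
  have hne' : e z ≠ e l := fun hEq => hlt.ne (hinj' hz.2.1 hl.2.1 hEq)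
  have hle : e z ≤ e l := by
    by_contra hcon
    have h1 := he' z (e l) (not_le.1 hcon)
    have h2 := he l
    omega
  have hp := hpar z hz.2.2 l hl.2.2
  have h2 : a (e z + 1 + 1) ≤ l := he' l (e z + 1) (by omega)
  exact hsub z _ (he z).le (hf l _ (hh _ l hl.1 ((hah _).trans h2)))

/-! ### Subtrees -/

namespace IsUCondition

variable {U : Ultrafilter ℕ} {T : NodeSet}

theorem exists_mem_succ (hT : IsUCondition U T) {l : ℕ} {t : Node l} (ht : t ∈ T l) :
    (T.succ t).Nonempty := by
  obtain ⟨m, h, hm, g, hg, rfl⟩ := hT.extend l t ht (l + 1) (Nat.le_succ l)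
  exact ⟨_, g.restrict hm, hT.subtree _ _ _ g hg, rfl, rfl⟩

theorem exists_mem (hT : IsUCondition U T) (l : ℕ) : (T l).Nonempty := by
  obtain ⟨m, h, hm, g, hg, -⟩ := hT.extend 0 (fun k => k.elim0) (hT.root _) l (Nat.zero_le l)
  exact ⟨g.restrict hm, hT.subtree _ _ _ g hg⟩

/-- An `n`-big subset of `2^l` requires `n ≤ l`, so a single condition already makes `U`
nonprincipal. -/
theorem ge_mem (hT : IsUCondition U T) (n : ℕ) : {l | n ≤ l} ∈ U := by
  refine Filter.mem_of_superset (hT.big n) fun l hl => ?_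
  obtain ⟨t, ht⟩ := hT.exists_mem l
  obtain ⟨-, -, h, -⟩ := hl t ht (fun _ => true)
  exact h

/-- The subtree of `T` of the nodes all of whose entries satisfy `C`. -/
def _root_.NodeSet.sub (T : NodeSet) (C : (l : ℕ) → (Fin l → Bool) → Prop) : NodeSet :=
  fun l => {t ∈ T l | ∀ k : Fin l, C k (t k)}

theorem _root_.NodeSet.succ_sub {T : NodeSet} {C : (l : ℕ) → (Fin l → Bool) → Prop} {l : ℕ}
    {t : Node l} (ht : t ∈ T.sub C l) : (T.sub C).succ t = {σ ∈ T.succ t | C l σ} := by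
  ext σ
  constructor
  · rintro ⟨g, hg, hr, rfl⟩
    exact ⟨⟨g, hg.1, hr, rfl⟩, hg.2 (Fin.last l)⟩
  · rintro ⟨⟨g, hg, rfl, rfl⟩, hC⟩
    refine ⟨g, ⟨hg, fun k => ?_⟩, rfl, rfl⟩
    induction k using Fin.lastCases with
    | last => exact hC
    | cast k => exact ht.2 k

theorem sub (hT : IsUCondition U T) {C : (l : ℕ) → (Fin l → Bool) → Prop}
    (hC : ∀ l, ∀ t ∈ T.sub C l, ∃ σ ∈ T.succ t, C l σ)
    (hbig : ∀ k, {l | ∀ t ∈ T.sub C l, IsBig k {σ ∈ T.succ t | C l σ}} ∈ U) :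
    IsUCondition U (T.sub C) where
  subtree l m h g hg := ⟨hT.subtree l m h g hg.1, fun k => hg.2 (Fin.castLE h k)⟩
  root f := ⟨hT.root f, fun k => k.elim0⟩
  extend l t ht n hn := by
    refine ⟨n, hn, le_rfl, ?_⟩
    induction n, hn using Nat.le_induction with
    | base => exact ⟨t, ht, rfl⟩
    | succ n hn ih =>
      obtain ⟨g, hg, rfl⟩ := ih
      obtain ⟨σ, hσ⟩ := hC n g hg
      have hσ' : σ ∈ (T.sub C).succ g := by rw [NodeSet.succ_sub hg]; exact hσ
      obtain ⟨g', hg', hr, -⟩ := hσ'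
      exact ⟨g', hg', by rw [← hr]; rfl⟩
  big k := by
    refine Filter.mem_of_superset (hbig k) fun l hl t ht => ?_
    rw [NodeSet.succ_sub ht]
    exact hl t ht

end IsUCondition

/-! ### Shrinking conditions -/

theorem IsBig.mono {k l : ℕ} {A B : Set (Fin l → Bool)} (h : IsBig k A) (hAB : A ⊆ B) :
    IsBig k B := fun σ => by
  obtain ⟨τ, hτ, h⟩ := h σ
  exact ⟨τ, hAB hτ, h⟩

/-- The nodes of a condition that are compatible with a given node form a condition. -/
theorem PU.exists_le_node {U : Ultrafilter ℕ} (T : PU U) {l : ℕ} {t : Node l} (ht : t ∈ T.1 l) :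
    ∃ S : PU U, S ≤ T ∧ ∀ s ∈ S.1 l, s = t := by
  let C : (m : ℕ) → (Fin m → Bool) → Prop := fun m σ => ∀ h : m < l, σ = t ⟨m, h⟩
  refine ⟨⟨T.1.sub C, T.2.sub (fun m s hs => ?_) fun k => ?_⟩, fun m s hs => hs.1,
    fun s hs => funext fun k => hs.2 k k.2⟩
  · by_cases h : m < l
    · refine ⟨t ⟨m, h⟩, ⟨t.restrict h, T.2.subtree _ _ _ t ht, ?_, rfl⟩, fun _ => rfl⟩
      exact funext fun k => (hs.2 k (k.2.trans h)).symm
    · obtain ⟨σ, hσ⟩ := T.2.exists_mem_succ hs.1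
      exact ⟨σ, hσ, fun h' => (h h').elim⟩
  · refine Filter.mem_of_superset (Filter.inter_mem (T.2.big k) (T.2.ge_mem l))
      fun m hm s hs => (hm.1 s hs.1).mono fun σ hσ => ⟨hσ, fun h' => ?_⟩
    exact absurd h' (not_lt.2 hm.2)

/-- A condition can be shrunk so that, for successive elements `z < l` of a suitable `Z ∈ U`, the
entries at level `l` take a given value on the interval `(z, g z]`. -/
theorem PU.exists_le_eq_on {U : Ultrafilter ℕ} (hU : IsSelectiveUltrafilter U) (T : PU U)
    (g h : ℕ → ℕ) (c : Bool) :
    ∃ S : PU U, S ≤ T ∧ ∃ Z ∈ U, ∀ l ∈ Z, ∃ z, h z ≤ l ∧ ∀ j, z < j → j ≤ g z →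
      ∃ hj : j < l, ∀ t ∈ S.1 (l + 1), t (Fin.last l) ⟨j, hj⟩ = c := by
  classical
  let W : ℕ → Set ℕ := fun z => {l | ∀ t ∈ T.1 l, IsBig (z + g z + 1) (T.1.succ t)} ∩ {l | h z ≤ l}
  obtain ⟨Z, hZ, hdiag⟩ := hU.exists_diagonal T.2.ge_mem (W := W)
    fun z => Filter.inter_mem (T.2.big _) (T.2.ge_mem _)
  -- `Pred z l`: `z` is the immediate predecessor of `l` in `Z`.
  let Pred : ℕ → ℕ → Prop := fun z l => z ∈ Z ∧ l ∈ Z ∧ z < l ∧ ∀ y ∈ Z, y < l → y ≤ z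
  have hPu : ∀ {z z' l}, Pred z l → Pred z' l → z = z' := fun hz hz' =>
    le_antisymm (hz'.2.2.2 _ hz.1 hz.2.2.1) (hz.2.2.2 _ hz'.1 hz'.2.2.1)
  have hPe : ∀ y ∈ Z, ∀ l ∈ Z, y < l → ∃ z, y ≤ z ∧ Pred z l := by
    intro y hy l hl hyl
    let P : ℕ → Prop := fun z => z ∈ Z ∧ z < l
    have hs : P (Nat.findGreatest P l) := Nat.findGreatest_spec hyl.le ⟨hy, hyl⟩
    exact ⟨Nat.findGreatest P l, Nat.le_findGreatest hyl.le ⟨hy, hyl⟩, hs.1, hl, hs.2,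
      fun x hx hxl => Nat.le_findGreatest hxl.le ⟨hx, hxl⟩⟩
  let C : (l : ℕ) → (Fin l → Bool) → Prop := fun l σ =>
    ∀ z, Pred z l → ∀ j : Fin l, z < j → j.1 ≤ g z → σ j = c
  -- The available bigness `z + g z + 1` covers both the first `z + 1` bits, left free, and the bits
  -- up to `g z`, set to `c`. So `z + 1`-bigness survives, and `z` grows with `l`.
  have hbig : ∀ z l, Pred z l → ∀ t ∈ T.1 l, IsBig (z + 1) {σ ∈ T.1.succ t | C l σ} := by
    intro z l hz t ht σ
    have hw : l ∈ W z := hdiag z hz.1 l hz.2.1 hz.2.2.1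
    obtain ⟨τ, hτ, hl, he⟩ := hw.1 t ht
      (fun i => if hi : i.1 < z + 1 then σ ⟨i, hi⟩ else c)
    refine ⟨τ, ⟨hτ, fun z' hz' j hj hj' => ?_⟩, hz.2.2.1, fun i => ?_⟩
    · cases hPu hz hz'
      exact (he ⟨j, by omega⟩).trans (dif_neg (by simp only; omega))
    · exact (he ⟨i, by omega⟩).trans (dif_pos i.2)
  have hS : IsUCondition U (T.1.sub C) := by
    refine T.2.sub (fun l t ht => ?_) fun k => ?_
    · by_cases hz : ∃ z, Pred z l
      · obtain ⟨z, hz⟩ := hz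
        obtain ⟨σ, hσ, -⟩ := hbig z l hz t ht.1 (fun _ => true)
        exact ⟨σ, hσ⟩
      · obtain ⟨σ, hσ⟩ := T.2.exists_mem_succ ht.1
        exact ⟨σ, hσ, fun z hz' => (hz ⟨z, hz'⟩).elim⟩
    · obtain ⟨y, hy, hky⟩ := U.nonempty_of_mem (Filter.inter_mem hZ (T.2.ge_mem k))
      refine Filter.mem_of_superset (Filter.inter_mem hZ (T.2.ge_mem (y + 1)))
        fun l hl t ht σ => ?_
      obtain ⟨z, hyz, hz⟩ := hPe y hy l hl.1 hl.2
      have hkz : k ≤ z + 1 := le_trans (le_trans hky hyz) (Nat.le_succ z)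
      obtain ⟨τ, hτ, hzl, he⟩ := hbig z l hz t ht.1
        (fun i => if hi : i.1 < k then σ ⟨i, hi⟩ else true)
      exact ⟨τ, hτ, hkz.trans hzl, fun i => (he (Fin.castLE hkz i)).trans (dif_pos i.2)⟩
  obtain ⟨y, hy⟩ := U.nonempty_of_mem hZ
  -- Only elements of `Z` above `y` are kept, so that each has a predecessor.
  refine ⟨⟨_, hS⟩, fun l t ht => ht.1, _, Filter.inter_mem hZ (T.2.ge_mem (y + 1)), fun l hl => ?_⟩
  obtain ⟨z, -, hz⟩ := hPe y hy l hl.1 hl.2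
  have hw : l ∈ W z := hdiag z hz.1 l hz.2.1 hz.2.2.1
  obtain ⟨t, ht⟩ := T.2.exists_mem l
  obtain ⟨-, -, hgl, -⟩ := hw.1 t ht (fun _ => true)
  exact ⟨z, hw.2, fun j hj hj' => ⟨by omega, fun s hs => hs.2 (Fin.last l) z hz _ hj hj'⟩⟩

/-! ### The generic branch -/

namespace Forcing

variable {U : Ultrafilter ℕ} {Q : Type u} [Preorder Q] {i : PU U → Q}

/-- `q` decides, by means of a condition of `ℙ(U)`, that the `j`-th bit of the `l`-th entry of the
generic branch is `b`. -/
def BitVal (i : PU U → Q) (l j : ℕ) (b : Bool) (q : Q) : Prop :=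
  ∃ T : PU U, q ≤ i T ∧ ∀ t ∈ T.1 (l + 1), ∃ hj : j < l, t (Fin.last l) ⟨j, hj⟩ = b

theorem BitVal.mono {l j : ℕ} {b : Bool} {p q : Q} (h : BitVal i l j b p) (hq : q ≤ p) :
    BitVal i l j b q := by
  obtain ⟨T, hT, h⟩ := h
  exact ⟨T, hq.trans hT, h⟩

/-- Compatibility in `Q` reflects to `ℙ(U)`, and a common extension there has a node at level `l +
1`. -/
theorem BitVal.unique (hi : IsCompleteEmbedding i) {l j : ℕ} {b b' : Bool} {q : Q}
    (h : BitVal i l j b q) (h' : BitVal i l j b' q) : b = b' := by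
  obtain ⟨T, hT, h⟩ := h
  obtain ⟨T', hT', h'⟩ := h'
  obtain ⟨S, hS, hS'⟩ := (hi.compat_iff T T').2 ⟨q, hT, hT'⟩
  obtain ⟨s, hs⟩ := S.2.exists_mem (l + 1)
  obtain ⟨hj, e⟩ := h s (hS _ hs)
  obtain ⟨hj', e'⟩ := h' s (hS' _ hs)
  exact e.symm.trans e'

/-- A reduction of `q` can be shrunk to one node at level `l + 1`, and its image stays compatible
with `q`. -/
theorem exists_bitVal (hi : IsCompleteEmbedding i) {l j : ℕ} (hj : j < l) (q : Q) :
    ∃ r ≤ q, ∃ b, BitVal i l j b r := by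
  obtain ⟨T, hT⟩ := hi.reduction q
  obtain ⟨t, ht⟩ := T.2.exists_mem (l + 1)
  obtain ⟨S, hS, h⟩ := T.exists_le_node ht
  obtain ⟨r, hr, hrq⟩ := hT S hS
  exact ⟨r, hrq, t (Fin.last l) ⟨j, hj⟩, S, hr, fun s hs => ⟨hj, by rw [h s hs]⟩⟩

/-- The name of the set of those `l` for which the `j`-th bit of the `l`-th entry of the generic
branch is `b`. -/
def bitSet (i : PU U → Q) (j : ℕ) (b : Bool) : PName Q :=
  bif b then setName fun l => BitVal i l j true else complName (setName fun l => BitVal i l j true)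

theorem BitVal.eq_of_mem (hi : IsCompleteEmbedding i) {l j : ℕ} {b b' : Bool} {q : Q}
    (h : BitVal i l j b q) (h' : mem (.nat l) (bitSet i j b') q) : b = b' := by
  cases b'
  · have := not_mem_of_mem_complName h'
    cases b
    · rfl
    · exact (this (nat_mem_setName_of h)).elim
  · obtain ⟨r, hr, c, hc, h''⟩ := exists_of_nat_mem_setName (S := fun l => BitVal i l j true) h'
    exact (h.mono hr).unique hi (h''.mono hc)

/-- The `n`-th bit of the `l`-th entry of the generic branch differs from the value it takes for
`V`-almost all `l`; or `n = l`. -/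
def Differs (i : PU U → Q) (V : PName Q) (l n : ℕ) (q : Q) : Prop :=
  (∃ b, BitVal i l n b q ∧ mem (bitSet i n (!b)) V q) ∨ n = l

theorem differs_mono {V : PName Q} (l n : ℕ) (p q : Q) (hq : q ≤ p) (h : Differs i V l n p) :
    Differs i V l n q :=
  h.imp_left fun ⟨b, h, h'⟩ => ⟨b, h.mono hq, mem_mono h' hq⟩

/-! ### Ultrafilters extending `U`, and why the function is not constant -/

section

variable {V : PName Q} {p : Q} (hi : IsCompleteEmbedding i) (hV : isUltrafilter V p)
  (hUV : subset (.ofUltrafilter U) V p)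

include hV hUV

theorem exists_mem_of_mem_ultrafilter {A : PName Q} {B : Set ℕ} {q : Q} (hq : q ≤ p)
    (hA : mem A V q) (hB : B ∈ U) : ∃ r ≤ q, ∃ l ∈ B, mem (.nat l) A r := by
  have hV' := isUltrafilter_mono hV hq
  obtain ⟨r, hr, l, hl⟩ := exists_nat_mem_of_mem hV'
    (interName_mem hV' (hUV _ q hq (ofSet_mem_ofUltrafilter hB q)) hA)
  exact ⟨r, hr, l, nat_mem_ofSet (mem_interName hl).1, (mem_interName hl).2⟩

include hi

theorem exists_bitVal_of_mem {A : PName Q} {n : ℕ} {b : Bool} {q : Q} (hq : q ≤ p)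
    (hA : mem A V q) (hb : mem (bitSet i n b) V q) :
    ∃ r ≤ q, ∃ l, n < l ∧ mem (.nat l) A r ∧ BitVal i l n b r := by
  -- Any condition will do here: it only supplies nonprincipality of `U`.
  obtain ⟨T, -⟩ := hi.reduction q
  obtain ⟨r, hr, l, hl, hm⟩ := exists_mem_of_mem_ultrafilter hV hUV hq
    (interName_mem (isUltrafilter_mono hV hq) hA hb) (T.2.ge_mem (n + 1))
  obtain ⟨s, hs, b', hb'⟩ := exists_bitVal hi (Nat.lt_of_succ_le hl) r
  obtain ⟨h₁, h₂⟩ := mem_interName (mem_mono hm hs)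
  exact ⟨s, hs.trans hr, l, hl, h₁, hb'.eq_of_mem hi h₂ ▸ hb'⟩

theorem bitSet_unique {n : ℕ} {b b' : Bool} {q : Q} (hq : q ≤ p)
    (hb : mem (bitSet i n b) V q) (hb' : mem (bitSet i n b') V q) : b = b' := by
  obtain ⟨r, hr, l, -, hl, h⟩ := exists_bitVal_of_mem hi hV hUV hq hb hb'
  exact (h.eq_of_mem hi hl).symm

omit hi hUV in
theorem exists_bitSet_mem (n : ℕ) {q : Q} (hq : q ≤ p) :
    ∃ r ≤ q, ∃ b, mem (bitSet i n b) V r := by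
  obtain ⟨r, hr, h | h⟩ := mem_or_complName_mem (isUltrafilter_mono hV hq)
    (setName_subset_omega (fun l => BitVal i l n true) q)
  · exact ⟨r, hr, true, h⟩
  · exact ⟨r, hr, false, h⟩

theorem not_constOn_differs {A : PName Q} {q : Q} (hq : q ≤ p) (hA : mem A V q) :
    ¬ constOn (funName (Differs i V)) A q := by
  intro hc
  obtain ⟨q₁, h₁, l, hl⟩ := exists_nat_mem_of_mem (isUltrafilter_mono hV hq) hA
  obtain ⟨q₂, h₂, n, -, hn⟩ := exists_least (R := Differs i V) (k := l) (p := q₁) (Or.inr rfl)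
  obtain ⟨q₃, h₃, b, hb⟩ := exists_bitSet_mem (i := i) hV n (h₂.trans (h₁.trans hq))
  have h₃q := h₃.trans (h₂.trans h₁)
  obtain ⟨r, hr, m, hnm, hm, hbm⟩ :=
    exists_bitVal_of_mem hi hV hUV (h₃q.trans hq) (mem_mono hA h₃q) hb
  obtain ⟨s, hs, n', -, hn'⟩ := exists_least (R := Differs i V) (k := m) (p := r) (Or.inr rfl)
  have hsq := hs.trans hr
  have e := hc (.nat l) s (hsq.trans h₃q) (mem_mono hl (hsq.trans (h₃.trans h₂))) (.nat m) s le_rfl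
    (mem_mono hm hs) (.nat n) (.nat n') s le_rfl
    ⟨mem_mono (opair_mem_funName hn) (hsq.trans h₃), opair_mem_funName hn'⟩
  cases nat_eq_nat.1 e
  -- The value at `m` would be `n`, but the `n`-th bit at `m` is the `V`-typical one and `n < m`.
  rcases hn'.1 with ⟨b', hb', hV'⟩ | rfl
  · cases hb'.unique hi (hbm.mono hs)
    have := bitSet_unique hi hV hUV (hsq.trans (h₃q.trans hq)) hV' (mem_mono hb hsq)
    cases b <;> cases this
  · exact hnm.false

end

/-! ### Injectivity, bounding and the contradiction -/

/-- A function one-to-one on `A` takes each value there at most once. By induction on `k`, a point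
of `A` beyond which values below `k` no longer occur is thus decided densely, and `ω^ω`-bounding
makes these points a ground model function. -/
theorem exists_bound_of_injOn (hQ : OmegaOmegaBounding Q) {R : ℕ → ℕ → Q → Prop}
    (hR : ∀ k n p q, q ≤ p → R k n p → R k n q) {A : PName Q} {p : Q}
    (h : injOn (funName R) A p) : ∃ q ≤ p, ∃ g : ℕ → ℕ, ∀ k, ∀ l, g k ≤ l → ∀ r ≤ q,
      mem (.nat l) A r → ∀ j < k, ¬ R l j r := by
  let B : ℕ → ℕ → Q → Prop := fun k m q =>
    ∀ l, m ≤ l → ∀ r ≤ q, mem (.nat l) A r → ∀ j < k, ¬ Least R l j r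
  have hB : ∀ k m p q, q ≤ p → B k m p → B k m q := fun k m p q hq h l hl r hr =>
    h l hl r (hr.trans hq)
  have hd : ∀ k, ∀ q ≤ p, ∃ r ≤ q, ∃ m, B k m r := by
    intro k q hq
    induction k with
    | zero => exact ⟨q, le_rfl, 0, fun l _ r _ _ j hj => (Nat.not_lt_zero j hj).elim⟩
    | succ k ih =>
      obtain ⟨r, hr, m, hm⟩ := ih
      by_cases hex : ∃ l, m ≤ l ∧ ∃ s ≤ r, mem (.nat l) A s ∧ Least R l k s
      · obtain ⟨l, hl, s, hs, hA, hls⟩ := hex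
        refine ⟨s, hs.trans hr, l + 1, fun l' hl' t ht hA' j hj hjt => ?_⟩
        rcases Nat.lt_succ_iff_lt_or_eq.1 hj with hj | rfl
        · exact hm l' (by omega) t (ht.trans hs) hA' j hj hjt
        · have e := h (.nat l) t (ht.trans (hs.trans (hr.trans hq))) (mem_mono hA ht) (.nat l') t
            le_rfl hA' (.nat j) t le_rfl
            ⟨mem_mono (opair_mem_funName hls) ht, opair_mem_funName hjt⟩
          have := nat_eq_nat.1 e
          omega
      · refine ⟨r, hr, m, fun l hl s hs hA j hj hjs => ?_⟩
        rcases Nat.lt_succ_iff_lt_or_eq.1 hj with hj | rfl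
        · exact hm l hl s hs hA j hj hjs
        · exact hex ⟨l, hl, s, hs, hA, hjs⟩
  obtain ⟨q, hq, g, hg⟩ := hQ.exists_bound hB hd
  refine ⟨q, hq, g, fun k l hl r hr hA j hj hRj => ?_⟩
  obtain ⟨s, hs, n, hn, hB'⟩ := hg k r hr
  obtain ⟨t, ht, m, hm, hlt⟩ := exists_least (hR _ _ _ _ hs hRj)
  exact hB' l (hn.trans hl) t ht (mem_mono hA (ht.trans hs)) m (hm.trans_lt hj) hlt

/-- Pigeonhole: if `true` is not typical infinitely often, some condition excludes it from some
index on, and below that condition `false` is typical at all later indices. -/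
theorem exists_frequent_bitSet {V : PName Q} {p : Q} (hV : isUltrafilter V p) :
    ∃ c, ∃ q ≤ p, ∀ k, ∀ r ≤ q, ∃ s ≤ r, ∃ j, k ≤ j ∧ mem (bitSet i j c) V s := by
  by_cases h : ∀ k, ∀ r ≤ p, ∃ s ≤ r, ∃ j, k ≤ j ∧ mem (bitSet i j true) V s
  · exact ⟨true, p, le_rfl, h⟩
  · push Not at h
    obtain ⟨k, q, hq, h⟩ := h
    refine ⟨false, q, hq, fun k' r hr => ?_⟩
    obtain ⟨s, hs, b, hb⟩ := exists_bitSet_mem (i := i) hV (max k k') (hr.trans hq)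
    cases b
    · exact ⟨s, hs, _, le_max_right k k', hb⟩
    · exact (h s (hs.trans hr) _ (le_max_left k k') hb).elim

theorem not_isSelective_of_subset (hU : IsSelectiveUltrafilter U) (hQ : OmegaOmegaBounding Q)
    (hi : IsCompleteEmbedding i) {V : PName Q} {p : Q} (hV : isSelective V p)
    (hUV : subset (.ofUltrafilter U) V p) : False := by
  obtain ⟨q₀, h₀, A, hA₀, hA⟩ := hV.2 (funName (Differs i V)) p le_rfl
    (isFun_funName differs_mono fun k q _ => ⟨q, le_rfl, k, Or.inr rfl⟩) p le_rfl
  obtain ⟨q₁, h₁, hc | hinj⟩ := hA q₀ le_rfl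
  · exact not_constOn_differs hi hV.1 hUV (h₁.trans h₀) (mem_mono hA₀ h₁) hc
  obtain ⟨q₂, h₂, h, hh⟩ := exists_bound_of_injOn hQ differs_mono hinj
  have h₂p := h₂.trans (h₁.trans h₀)
  obtain ⟨c, q₃, h₃, hc⟩ := exists_frequent_bitSet (i := i) (isUltrafilter_mono hV.1 h₂p)
  obtain ⟨q₄, h₄, g, hg⟩ := hQ.exists_bound (p := q₃)
    (R := fun k j q => k ≤ j ∧ mem (bitSet i j c) V q)
    (fun k j p q hq h => ⟨h.1, mem_mono h.2 hq⟩) hc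
  obtain ⟨T, hT⟩ := hi.reduction q₄
  -- Applying `g` at `z + 1` puts the typical-`c` index `j` strictly above `z`; since only `j ≤ g (z
  -- + 1)` is known, `h` is taken one further.
  obtain ⟨S, hS, Z, hZ, hSZ⟩ :=
    T.exists_le_eq_on hU (fun z => g (z + 1)) (fun z => h (g (z + 1) + 1)) (!c)
  obtain ⟨q₅, h₅, h₅'⟩ := hT S hS
  have h₅₂ := h₅'.trans (h₄.trans h₃)
  obtain ⟨r, hr, l, hl, hlA⟩ := exists_mem_of_mem_ultrafilter hV.1 hUV (h₅₂.trans h₂p)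
    (mem_mono hA₀ (h₅₂.trans (h₂.trans h₁))) hZ
  obtain ⟨z, hz, hj⟩ := hSZ l hl
  obtain ⟨s, hs, j, hjg, hzj, hb⟩ := hg (z + 1) r (hr.trans h₅')
  have hsl : BitVal i l j (!c) s := by
    obtain ⟨hjl, ht⟩ := hj j hzj hjg
    exact ⟨S, hs.trans (hr.trans h₅), fun t hst => ⟨hjl, ht t hst⟩⟩
  -- At `l ∈ A ∩ Z` the `j`-th bit is `!c` while the typical one is `c`, so `Differs` holds at a `j`
  -- that `h` has excluded.
  refine hh _ l hz s (hs.trans (hr.trans h₅₂)) (mem_mono hlA hs) j (Nat.lt_succ_of_le hjg)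
    (Or.inl ⟨!c, hsl, ?_⟩)
  rwa [Bool.not_not]

end Forcing

theorem mainTheorem7 (U : Ultrafilter ℕ) (hU : IsSelectiveUltrafilter U)
    (Q : Type u) [Preorder Q] (hQ : Forcing.OmegaOmegaBounding Q)
    (hemb : ∃ i : PU U → Q, Forcing.IsCompleteEmbedding i) :
    ∀ p : Q, Forcing.neg (Forcing.ex fun V : Forcing.PName Q =>
      Forcing.and (Forcing.isSelective V)
        (Forcing.subset (Forcing.PName.ofUltrafilter U) V)) p := by
  obtain ⟨i, hi⟩ := hemb
  intro p q _ h
  obtain ⟨r, -, V, hV, hUV⟩ := h q le_rfl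
  exact Forcing.not_isSelective_of_subset hU hQ hi hV hUV
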